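/- Let $\Gamma$ be an additive abelian group, let $A=\bigoplus_{\gamma\in\Gamma}A_\gamma$ be a unital $\Gamma$-graded ring, let $n\ge 1$ and $\overline{\delta}=(\delta_1,\dots,\delta_n)\in\Gamma^n$. Let $M_n(A)(\overline{\delta})$ be the ring $M_n(A)$ with the $\Gamma$-grading in which $(a_{i,j})$ is homogeneous of degree $\lambda$ if and only if $a_{i,j}\in A_{\lambda+\delta_j-\delta_i}$ for all $i,j$, and let $\iota\colon A\to M_n(A)(\overline{\delta})$, $a\mapsto a\,e_{1,1}$, be the (degree-preserving, multiplicative, in general non-unital) inclusion into the $e_{1,1}$ corner. For a unital $\Gamma$-graded ring $R$, let $K_0^{\operatorname{gr}}(R)$ be the group completion of the commutative monoid, under direct sum, of graded isomorphism classes of finitely generated graded projective right $R$-modules. It is a $\mathbb{Z}[\Gamma]$-module via $\gamma\cdot[P]=[P(\gamma)]$, where $P(\gamma)_\lambda=P_{\gamma+\lambda}$, and it is preordered by $x\le y$ if and only if $y-x=[P]$ for some finitely generated graded projective right $R$-module $P$. For a graded right $A$-module $P$, regard $M_n(A)$ as a left $A$-module via $\iota$, and let $P\otimes_A M_n(A)(\overline{\delta})$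 be the quotient of $P\otimes_{\mathbb{Z}}M_n(A)$ by the subgroup generated by all $pa\otimes x-p\otimes\iota(a)x$, with right $M_n(A)$-action $(p\otimes x)y=p\otimes xy$, and with degree $\lambda$ component generated by the $p\otimes x$ with $p,x$ homogeneous and $\deg p+\deg x=\lambda$; this is a graded right $M_n(A)(\overline{\delta})$-module. Then, for every finitely generated graded projective right $A$-module $P$, the graded right $M_n(A)(\overline{\delta})$-module $P\otimes_A M_n(A)(\overline{\delta})$ is finitely generated and projective, and there is an isomorphism of $\mathbb{Z}[\Gamma]$-modules $$K_0^{\operatorname{gr}}(\iota)\colon K_0^{\operatorname{gr}}(A)\to K_0^{\operatorname{gr}}\bigl(M_n(A)(\overline{\delta})\bigr),\qquad K_0^{\operatorname{gr}}(\iota)([P])=\bigl[P\otimes_A M_n(A)(\overline{\delta})\bigr],$$ which is an order isomorphism: $K_0^{\operatorname{gr}}(\iota)(x)\le K_0^{\operatorname{gr}}(\iota)(y)$ if and only if $x\le y$. -/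

import Mathlib

open scoped TensorProduct DirectSum

noncomputable section

namespace GradedK0

universe u v

/-! ### Internal direct sums of subgroups -/

section Internal

variable {Γ : Type v} [DecidableEq Γ] {T : Type u} [AddCommGroup T]

/-- The projection of a graded abelian group onto its component of degree `i`. -/
def projHom (G : Γ → AddSubgroup T) [DirectSum.Decomposition G] (i : Γ) : T →+ T where
  toFun x := (DirectSum.decompose G x i : T)
  map_zero' := by simp
  map_add' x y := by simp

theorem projHom_same (G : Γ → AddSubgroup T) [DirectSum.Decomposition G] {i : Γ} {x : T}
    (hx : x ∈ G i) : projHom G i x = x :=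
  DirectSum.decompose_of_mem_same G hx

theorem projHom_ne (G : Γ → AddSubgroup T) [DirectSum.Decomposition G] {i j : Γ} {x : T}
    (hx : x ∈ G i) (h : i ≠ j) : projHom G j x = 0 :=
  DirectSum.decompose_of_mem_ne G hx h

theorem projHom_mem (G : Γ → AddSubgroup T) [DirectSum.Decomposition G] (i : Γ) (x : T) :
    projHom G i x ∈ G i := (DirectSum.decompose G x i).2

/-- A family of subgroups that spans and admits projections is an internal direct sum. -/
theorem isInternal_of_proj (G : Γ → AddSubgroup T) (p : Γ → T →+ T)
    (same : ∀ i, ∀ x ∈ G i, p i x = x) (ne : ∀ i j, i ≠ j → ∀ x ∈ G i, p j x = 0)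
    (span : ∀ x, x ∈ ⨆ i, G i) : DirectSum.IsInternal G := by
  have key : ∀ (i : Γ) (x : ⨁ i, G i), p i (DirectSum.coeAddMonoidHom G x) = (x i : T) := by
    intro i x
    induction x using DirectSum.induction_on with
    | zero => simp
    | of j y =>
      rw [DirectSum.coeAddMonoidHom_of]
      by_cases h : j = i
      · subst h
        rw [same j _ y.2, DirectSum.of_eq_same]
      · rw [ne j i h _ y.2, DirectSum.of_eq_of_ne _ _ _ (Ne.symm h)]
        rfl
    | add x y hx hy => simp [hx, hy]
  constructor
  · intro x y h
    refine DFinsupp.ext fun i => Subtype.ext ?_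
    have h' : DirectSum.coeAddMonoidHom G x = DirectSum.coeAddMonoidHom G y := h
    rw [← key i x, ← key i y, h']
  · intro x
    refine AddSubgroup.iSup_induction G
      (C := fun x => ∃ a, DirectSum.coeAddMonoidHom G a = x) (span x) ?_ ?_ ?_
    · intro i x hx
      exact ⟨DirectSum.of (fun i => G i) i ⟨x, hx⟩, DirectSum.coeAddMonoidHom_of _ _ _⟩
    · exact ⟨0, map_zero _⟩
    · rintro x y ⟨a, rfl⟩ ⟨b, rfl⟩
      exact ⟨a + b, map_add _ _ _⟩

theorem mem_iSup_of_isInternal {G : Γ → AddSubgroup T} (h : DirectSum.IsInternal G) (x : T) :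
    x ∈ ⨆ i, G i := by
  obtain ⟨a, rfl⟩ := h.2 x
  induction a using DirectSum.induction_on with
  | zero => rw [map_zero]; exact zero_mem _
  | of i y =>
    rw [DirectSum.coeAddMonoidHom_of]
    exact AddSubgroup.mem_iSup_of_mem i y.2
  | add y z hy hz => rw [map_add]; exact add_mem hy hz

end Internal

/-! ### Graded right modules -/

section Modules

variable {Γ : Type v} [DecidableEq Γ] [AddCommGroup Γ] {A : Type u} [Ring A]

/-- A `Γ`-graded right module `M = ⨁ M_γ` over the `Γ`-graded ring `A = ⨁ A_γ`, with
`M_i A_j ⊆ M_{i + j}`. Right modules are modules over the opposite ring. -/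
structure GrMod (𝒜 : Γ → AddSubgroup A) where
  carrier : Type u
  [addCommGroup : AddCommGroup carrier]
  [module : Module Aᵐᵒᵖ carrier]
  deg : Γ → AddSubgroup carrier
  isInternal : DirectSum.IsInternal deg
  smul_mem : ∀ {i j : Γ} {m : carrier} {a : A}, m ∈ deg i → a ∈ 𝒜 j →
    MulOpposite.op a • m ∈ deg (i + j)

attribute [instance] GrMod.addCommGroup GrMod.module

variable {𝒜 : Γ → AddSubgroup A}

/-- Graded isomorphism: an `A`-linear bijection preserving degrees. -/
def GrMod.Iso (M N : GrMod 𝒜) : Prop :=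
  ∃ e : M.carrier ≃ₗ[Aᵐᵒᵖ] N.carrier, ∀ i m, m ∈ M.deg i ↔ e m ∈ N.deg i

theorem GrMod.Iso.refl (M : GrMod 𝒜) : M.Iso M := ⟨LinearEquiv.refl _ _, fun _ _ => Iff.rfl⟩

theorem GrMod.Iso.symm {M N : GrMod 𝒜} : M.Iso N → N.Iso M := by
  rintro ⟨e, he⟩
  exact ⟨e.symm, fun i m => by rw [he, e.apply_symm_apply]⟩

theorem GrMod.Iso.trans {M N P : GrMod 𝒜} : M.Iso N → N.Iso P → M.Iso P := by
  rintro ⟨e, he⟩ ⟨f, hf⟩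
  exact ⟨e.trans f, fun i m => by rw [he, hf]; rfl⟩

/-- The zero graded module. -/
def GrMod.zero (𝒜 : Γ → AddSubgroup A) : GrMod 𝒜 where
  carrier := PUnit.{u + 1}
  deg _ := ⊤
  isInternal := isInternal_of_proj _ (fun _ => 0) (fun _ _ _ => rfl) (fun _ _ _ _ _ => rfl)
    (fun x => by rw [Subsingleton.elim x 0]; exact zero_mem _)
  smul_mem _ _ := trivial

/-- The direct sum of graded modules, `(M ⊕ N)_i = M_i ⊕ N_i`. -/
def GrMod.sum (M N : GrMod 𝒜) : GrMod 𝒜 where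
  carrier := M.carrier × N.carrier
  deg i := (M.deg i).prod (N.deg i)
  isInternal := by
    let _ := M.isInternal.chooseDecomposition
    let _ := N.isInternal.chooseDecomposition
    refine isInternal_of_proj _ (fun i => (projHom M.deg i).prodMap (projHom N.deg i)) ?_ ?_ ?_
    · rintro i ⟨x, y⟩ h
      exact Prod.ext (projHom_same _ h.1) (projHom_same _ h.2)
    · rintro i j hij ⟨x, y⟩ h
      exact Prod.ext (projHom_ne _ h.1 hij) (projHom_ne _ h.2 hij)
    · rintro ⟨x, y⟩
      have hx : ∀ x : M.carrier, (x, (0 : N.carrier)) ∈ ⨆ i, (M.deg i).prod (N.deg i) := by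
        intro x
        refine AddSubgroup.iSup_induction M.deg (C := fun x => (x, (0 : N.carrier)) ∈ _)
          (mem_iSup_of_isInternal M.isInternal x) ?_ (zero_mem _) ?_
        · intro i x hx
          exact AddSubgroup.mem_iSup_of_mem i ⟨hx, zero_mem _⟩
        · intro a b ha hb
          simpa using add_mem ha hb
      have hy : ∀ y : N.carrier, ((0 : M.carrier), y) ∈ ⨆ i, (M.deg i).prod (N.deg i) := by
        intro x
        refine AddSubgroup.iSup_induction N.deg (C := fun x => ((0 : M.carrier), x) ∈ _)
          (mem_iSup_of_isInternal N.isInternal x) ?_ (zero_mem _) ?_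
        · intro i x hx
          exact AddSubgroup.mem_iSup_of_mem i ⟨zero_mem _, hx⟩
        · intro a b ha hb
          simpa using add_mem ha hb
      simpa using add_mem (hx x) (hy y)
  smul_mem hm ha := ⟨GrMod.smul_mem M hm.1 ha, GrMod.smul_mem N hm.2 ha⟩

/-- The shifted module `M(γ)`, with `M(γ)_i = M_{γ + i}`. -/
def GrMod.shift (γ : Γ) (M : GrMod 𝒜) : GrMod 𝒜 where
  carrier := M.carrier
  deg i := M.deg (γ + i)
  isInternal := by
    let _ := M.isInternal.chooseDecomposition
    refine isInternal_of_proj _ (fun i => projHom M.deg (γ + i)) ?_ ?_ ?_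
    · intro i x h
      exact projHom_same _ h
    · intro i j hij x h
      exact projHom_ne _ h (by simpa using hij)
    · intro x
      refine AddSubgroup.iSup_induction M.deg (C := fun x => x ∈ _)
        (mem_iSup_of_isInternal M.isInternal x) ?_ (zero_mem _) fun _ _ ha hb => add_mem ha hb
      intro i x hx
      refine AddSubgroup.mem_iSup_of_mem (i - γ) ?_
      simpa using hx
  smul_mem hm ha := by
    rw [← add_assoc]
    exact GrMod.smul_mem M hm ha

/-- Finitely generated graded projective right modules. (A graded module is a projective object
among graded modules precisely if its underlying module is projective.) -/
structure PGr (𝒜 : Γ → AddSubgroup A) extends GrMod 𝒜 where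
  finite : Module.Finite Aᵐᵒᵖ carrier
  projective : Module.Projective Aᵐᵒᵖ carrier

/-- Graded isomorphism as an equivalence relation on finitely generated graded projectives. -/
instance PGr.setoid (𝒜 : Γ → AddSubgroup A) : Setoid (PGr 𝒜) where
  r P Q := P.toGrMod.Iso Q.toGrMod
  iseqv := ⟨fun P => GrMod.Iso.refl P.toGrMod, GrMod.Iso.symm, GrMod.Iso.trans⟩

def PGr.zero (𝒜 : Γ → AddSubgroup A) : PGr 𝒜 where
  toGrMod := GrMod.zero 𝒜
  finite := inferInstanceAs (Module.Finite Aᵐᵒᵖ PUnit.{u + 1})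
  projective := inferInstanceAs (Module.Projective Aᵐᵒᵖ PUnit.{u + 1})

def PGr.sum (P Q : PGr 𝒜) : PGr 𝒜 where
  toGrMod := P.toGrMod.sum Q.toGrMod
  finite := by
    have := P.finite
    have := Q.finite
    exact inferInstanceAs (Module.Finite Aᵐᵒᵖ (P.carrier × Q.carrier))
  projective := by
    have := P.projective
    have := Q.projective
    exact inferInstanceAs (Module.Projective Aᵐᵒᵖ (P.carrier × Q.carrier))

def PGr.shift (γ : Γ) (P : PGr 𝒜) : PGr 𝒜 where
  toGrMod := P.toGrMod.shift γ
  finite := P.finite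
  projective := P.projective

/-! ### The monoid of isomorphism classes and the graded Grothendieck group -/

/-- The set of graded isomorphism classes of finitely generated graded projective modules. -/
def V (𝒜 : Γ → AddSubgroup A) : Type (max (u + 1) v) := Quotient (PGr.setoid 𝒜)

/-- The class of a module in the set of isomorphism classes. -/
def V.mk (P : PGr 𝒜) : V 𝒜 := Quotient.mk _ P

/-- Addition of classes is induced by direct sum. -/
instance : Add (V 𝒜) where
  add := Quotient.map₂ PGr.sum fun _ _ ⟨e, he⟩ _ _ ⟨f, hf⟩ =>
    ⟨e.prodCongr f, fun i m => and_congr (he i m.1) (hf i m.2)⟩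

instance : Zero (V 𝒜) where
  zero := V.mk (PGr.zero 𝒜)

instance : AddCommMonoid (V 𝒜) where
  nsmul := nsmulRec
  add_assoc := by
    rintro ⟨P⟩ ⟨Q⟩ ⟨R⟩
    exact Quotient.sound ⟨LinearEquiv.prodAssoc Aᵐᵒᵖ P.carrier Q.carrier R.carrier,
      fun i m => and_assoc⟩
  zero_add := by
    rintro ⟨P⟩
    exact Quotient.sound ⟨LinearEquiv.uniqueProd (R := Aᵐᵒᵖ) (M := P.carrier) (M₂ := PUnit.{u + 1}),
      fun i m => ⟨fun h => h.2, fun h => ⟨trivial, h⟩⟩⟩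
  add_zero := by
    rintro ⟨P⟩
    exact Quotient.sound ⟨LinearEquiv.prodUnique (R := Aᵐᵒᵖ) (M := P.carrier) (M₂ := PUnit.{u + 1}),
      fun i m => ⟨fun h => h.1, fun h => ⟨h, trivial⟩⟩⟩
  add_comm := by
    rintro ⟨P⟩ ⟨Q⟩
    exact Quotient.sound ⟨LinearEquiv.prodComm Aᵐᵒᵖ P.carrier Q.carrier, fun i m => and_comm⟩

/-- The endomorphism `[P] ↦ [P(γ)]` of the monoid of isomorphism classes. -/
def V.shift (𝒜 : Γ → AddSubgroup A) (γ : Γ) : V 𝒜 →+ V 𝒜 where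
  toFun := Quotient.map (PGr.shift γ) fun _ _ ⟨e, he⟩ => ⟨e, fun i m => he (γ + i) m⟩
  map_zero' := Quotient.sound ⟨LinearEquiv.refl _ _, fun _ _ => Iff.rfl⟩
  map_add' := by
    rintro ⟨P⟩ ⟨Q⟩
    exact Quotient.sound ⟨LinearEquiv.refl _ _, fun _ _ => Iff.rfl⟩

/-- The graded Grothendieck group: the group completion of the monoid of graded isomorphism
classes of finitely generated graded projective right modules. -/
def K0gr (𝒜 : Γ → AddSubgroup A) : Type (max (u + 1) v) := Algebra.GrothendieckAddGroup (V 𝒜)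

instance : AddCommGroup (K0gr 𝒜) := inferInstanceAs (AddCommGroup (Algebra.GrothendieckAddGroup _))

/-- The canonical homomorphism from isomorphism classes to the graded Grothendieck group. -/
def K0gr.of (𝒜 : Γ → AddSubgroup A) : V 𝒜 →+ K0gr 𝒜 := Algebra.GrothendieckAddGroup.of

/-- The class `[P]` in the graded Grothendieck group. -/
def K0gr.mk (P : PGr 𝒜) : K0gr 𝒜 := K0gr.of 𝒜 (V.mk P)

theorem K0gr.hom_ext {G : Type*} [AddCommGroup G] {f g : K0gr 𝒜 →+ G}
    (h : ∀ P : PGr 𝒜, f (K0gr.mk P) = g (K0gr.mk P)) : f = g := by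
  refine Algebra.GrothendieckAddGroup.lift.symm.injective (AddMonoidHom.ext ?_)
  rintro ⟨P⟩
  exact h P

/-- The endomorphism of the graded Grothendieck group with `[P] ↦ [P(γ)]`. -/
def K0gr.shift (𝒜 : Γ → AddSubgroup A) (γ : Γ) : AddMonoid.End (K0gr 𝒜) :=
  Algebra.GrothendieckAddGroup.lift ((K0gr.of 𝒜).comp (V.shift 𝒜 γ))

theorem K0gr.shift_mk (γ : Γ) (P : PGr 𝒜) :
    K0gr.shift 𝒜 γ (K0gr.mk P) = K0gr.mk (P.shift γ) :=
  DFunLike.congr_fun (Algebra.GrothendieckAddGroup.lift.symm_apply_apply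
    ((K0gr.of 𝒜).comp (V.shift 𝒜 γ))) (V.mk P)

/-- The action of `Γ` on the graded Grothendieck group by shifts. -/
def K0gr.shiftHom (𝒜 : Γ → AddSubgroup A) : Multiplicative Γ →* AddMonoid.End (K0gr 𝒜) where
  toFun γ := K0gr.shift 𝒜 γ.toAdd
  map_one' := K0gr.hom_ext fun P => by
    refine (K0gr.shift_mk _ P).trans ?_
    refine congrArg (K0gr.of 𝒜) (Quotient.sound ⟨LinearEquiv.refl _ _, fun i m => ?_⟩)
    change m ∈ P.deg ((0 : Γ) + i) ↔ m ∈ P.deg i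
    rw [zero_add]
  map_mul' γ ε := K0gr.hom_ext fun P => by
    change K0gr.shift 𝒜 _ _ = K0gr.shift 𝒜 _ (K0gr.shift 𝒜 _ _)
    rw [K0gr.shift_mk, K0gr.shift_mk, K0gr.shift_mk]
    refine congrArg (K0gr.of 𝒜) (Quotient.sound ⟨LinearEquiv.refl _ _, fun i m => ?_⟩)
    change m ∈ P.deg (γ.toAdd + ε.toAdd + i) ↔ m ∈ P.deg (ε.toAdd + (γ.toAdd + i))
    rw [add_comm γ.toAdd, add_assoc]

/-- The `ℤ[Γ]`-module structure on the graded Grothendieck group, in which `γ ∈ Γ` acts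
by `γ [P] = [P(γ)]`. -/
instance : Module (AddMonoidAlgebra ℤ Γ) (K0gr 𝒜) :=
  Module.compHom (K0gr 𝒜)
    (AddMonoidAlgebra.lift ℤ (AddMonoid.End (K0gr 𝒜)) Γ (K0gr.shiftHom 𝒜)).toRingHom

theorem K0gr.single_smul_mk (γ : Γ) (P : PGr 𝒜) :
    AddMonoidAlgebra.single γ (1 : ℤ) • K0gr.mk P = K0gr.mk (P.shift γ) := by
  change AddMonoidAlgebra.lift ℤ (AddMonoid.End (K0gr 𝒜)) Γ (K0gr.shiftHom 𝒜)
    (AddMonoidAlgebra.single γ (1 : ℤ)) (K0gr.mk P) = _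
  rw [AddMonoidAlgebra.lift_single, one_smul]
  exact K0gr.shift_mk γ P

/-- The canonical (pre)order: `x ≤ y` if `y - x` is the class of a finitely generated graded
projective module. -/
instance : Preorder (K0gr 𝒜) where
  le x y := ∃ P : PGr 𝒜, y - x = K0gr.mk P
  le_refl x := ⟨PGr.zero 𝒜, by rw [sub_self]; exact (map_zero (K0gr.of 𝒜)).symm⟩
  le_trans x y z := by
    rintro ⟨P, hP⟩ ⟨Q, hQ⟩
    refine ⟨Q.sum P, ?_⟩
    rw [← sub_add_sub_cancel z y x, hP, hQ]
    exact (map_add (K0gr.of 𝒜) (V.mk Q) (V.mk P)).symm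

end Modules

/-! ### Graded tensor product with a graded ring along a graded homomorphism -/

section BaseChange

variable {Γ : Type v} [DecidableEq Γ] [AddCommGroup Γ] {A B : Type u} [Ring A] [Ring B]

/-- The subgroup of `M ⊗ B` generated by the elements `m a ⊗ b - m ⊗ φ(a) b`. -/
def balanced (φ : A →ₙ+* B) (M : Type u) [AddCommGroup M] [Module Aᵐᵒᵖ M] :
    AddSubgroup (M ⊗[ℤ] B) :=
  AddSubgroup.closure {x | ∃ (m : M) (a : A) (b : B),
    x = (MulOpposite.op a • m) ⊗ₜ[ℤ] b - m ⊗ₜ[ℤ] (φ a * b)}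

/-- The tensor product `M ⊗_A B` of a right `A`-module `M` with the `A`-`B`-bimodule `B`, where the
left action of `A` on `B` is `a b = φ(a) b`. The homomorphism `φ` need not preserve the unit. -/
def Tensor (φ : A →ₙ+* B) (M : Type u) [AddCommGroup M] [Module Aᵐᵒᵖ M] : Type u :=
  (M ⊗[ℤ] B) ⧸ balanced φ M

namespace Tensor

variable (φ : A →ₙ+* B) {M : Type u} [AddCommGroup M] [Module Aᵐᵒᵖ M]

instance : AddCommGroup (Tensor φ M) := inferInstanceAs (AddCommGroup ((M ⊗[ℤ] B) ⧸ balanced φ M))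

/-- The class of `m ⊗ b` as a biadditive function. -/
def tmul : M →+ B →+ Tensor φ M :=
  AddMonoidHom.mk' (fun m => AddMonoidHom.mk' (fun b => QuotientAddGroup.mk (m ⊗ₜ[ℤ] b))
      fun b c => by rw [TensorProduct.tmul_add]; rfl)
    fun m n => by
      ext b
      change (QuotientAddGroup.mk ((m + n) ⊗ₜ[ℤ] b) : (M ⊗[ℤ] B) ⧸ balanced φ M) = _
      rw [TensorProduct.add_tmul]
      rfl

theorem tmul_balanced (m : M) (a : A) (b : B) :
    tmul φ (MulOpposite.op a • m) b = tmul φ m (φ a * b) :=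
  QuotientAddGroup.eq_iff_sub_mem.2 (AddSubgroup.subset_closure ⟨m, a, b, rfl⟩)

@[elab_as_elim]
theorem induction {motive : Tensor φ M → Prop} (zero : motive 0)
    (tmul : ∀ m b, motive (tmul φ m b)) (add : ∀ x y, motive x → motive y → motive (x + y))
    (x : Tensor φ M) : motive x := by
  obtain ⟨x, rfl⟩ := QuotientAddGroup.mk_surjective x
  induction x using TensorProduct.induction_on with
  | zero => exact zero
  | tmul m b => exact tmul m b
  | add x y hx hy => exact add _ _ hx hy

variable {φ} in
/-- The universal property with respect to balanced biadditive functions. -/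
def lift {G : Type*} [AddCommGroup G] (f : M →+ B →+ G)
    (hf : ∀ m a b, f (MulOpposite.op a • m) b = f m (φ a * b)) : Tensor φ M →+ G :=
  QuotientAddGroup.lift (balanced φ M)
    (TensorProduct.liftAddHom f fun r m b => by rw [map_zsmul, map_zsmul, AddMonoidHom.zsmul_apply])
    ((AddSubgroup.closure_le _).2 (by
      rintro _ ⟨m, a, b, rfl⟩
      change _ = _
      rw [map_sub, TensorProduct.liftAddHom_tmul, TensorProduct.liftAddHom_tmul, hf, sub_self]))

theorem lift_tmul {G : Type*} [AddCommGroup G] (f : M →+ B →+ G)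
    (hf : ∀ m a b, f (MulOpposite.op a • m) b = f m (φ a * b)) (m : M) (b : B) :
    lift f hf (tmul φ m b) = f m b := rfl

/-- Right multiplication by `c` on `M ⊗_A B`. -/
def rightMul (c : B) : Tensor φ M →+ Tensor φ M :=
  lift ((AddMonoidHom.compHom.flip (AddMonoidHom.mulRight c)).comp (tmul φ)) fun m a b => by
    change tmul φ (MulOpposite.op a • m) (b * c) = tmul φ m (φ a * b * c)
    rw [tmul_balanced, mul_assoc]

theorem rightMul_tmul (c : B) (m : M) (b : B) :
    rightMul φ c (tmul φ m b) = tmul φ m (b * c) := rfl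

/-- The right `B`-module structure `(m ⊗ b) c = m ⊗ b c`. -/
instance : Module Bᵐᵒᵖ (Tensor φ M) where
  smul c x := rightMul φ c.unop x
  one_smul x := by
    change rightMul φ _ _ = _
    induction x using induction with
    | zero => exact map_zero _
    | tmul m b => rw [rightMul_tmul, MulOpposite.unop_one, mul_one]
    | add x y hx hy => rw [map_add, hx, hy]
  mul_smul c d x := by
    change rightMul φ _ _ = rightMul φ _ (rightMul φ _ _)
    induction x using induction with
    | zero => simp only [map_zero]
    | tmul m b => rw [rightMul_tmul, rightMul_tmul, rightMul_tmul, MulOpposite.unop_mul, mul_assoc]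
    | add x y hx hy => rw [map_add, hx, hy, map_add, map_add]
  smul_zero c := map_zero (rightMul φ c.unop)
  smul_add c := map_add (rightMul φ c.unop)
  add_smul c d x := by
    change rightMul φ _ _ = rightMul φ _ _ + rightMul φ _ _
    induction x using induction with
    | zero => simp only [map_zero, add_zero]
    | tmul m b =>
      rw [rightMul_tmul, rightMul_tmul, rightMul_tmul, MulOpposite.unop_add, mul_add, map_add]
    | add x y hx hy => rw [map_add, hx, hy, map_add, map_add, add_add_add_comm]
  zero_smul x := by
    change rightMul φ _ _ = _
    induction x using induction with
    | zero => exact map_zero _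
    | tmul m b => rw [rightMul_tmul, MulOpposite.unop_zero, mul_zero, map_zero]
    | add x y hx hy => rw [map_add, hx, hy, add_zero]

theorem op_smul_tmul (c : B) (m : M) (b : B) :
    MulOpposite.op c • tmul φ m b = tmul φ m (b * c) := rfl

/-- The grading of the tensor product: the degree `l` part is generated by the `m ⊗ b` with `m`, `b`
homogeneous of degrees adding up to `l`. -/
def deg (ℳ : Γ → AddSubgroup M) (ℬ : Γ → AddSubgroup B) (l : Γ) : AddSubgroup (Tensor φ M) :=
  AddSubgroup.closure {x | ∃ i j, i + j = l ∧ ∃ m ∈ ℳ i, ∃ b ∈ ℬ j, x = tmul φ m b}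

theorem deg_isInternal {𝒜 : Γ → AddSubgroup A} [GradedRing 𝒜] {ℬ : Γ → AddSubgroup B}
    [GradedRing ℬ] (hφ : ∀ i, ∀ a ∈ 𝒜 i, φ a ∈ ℬ i) (M : GrMod 𝒜) :
    DirectSum.IsInternal (deg φ M.deg ℬ) := by
  let _ := M.isInternal.chooseDecomposition
  let q : Γ → M.carrier →+ B →+ Tensor φ M.carrier := fun l =>
    (DirectSum.toAddMonoid fun i =>
      (AddMonoidHom.compHom.flip (projHom ℬ (l - i))).comp
        ((tmul φ).comp (M.deg i).subtype)).comp
      (DirectSum.decomposeAddEquiv M.deg).toAddMonoidHom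
  have hq : ∀ l i, ∀ m ∈ M.deg i, ∀ b, q l m b = tmul φ m (projHom ℬ (l - i) b) := by
    intro l i m hm b
    change (DirectSum.toAddMonoid (fun i => (AddMonoidHom.compHom.flip (projHom ℬ (l - i))).comp
        ((tmul φ).comp (M.deg i).subtype)) (DirectSum.decompose M.deg m)) b = _
    rw [DirectSum.decompose_of_mem _ hm, DirectSum.toAddMonoid_of]
    rfl
  have hbal : ∀ l m a b, q l (MulOpposite.op a • m) b = q l m (φ a * b) := by
    intro l m a b
    induction m using DirectSum.Decomposition.inductionOn M.deg with
    | zero => simp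
    | add m n hm hn => simp only [smul_add, map_add, AddMonoidHom.add_apply, hm, hn]
    | @homogeneous i m =>
      induction a using DirectSum.Decomposition.inductionOn 𝒜 with
      | zero => simp
      | add a c ha hc =>
        simp only [MulOpposite.op_add, add_smul, add_mul, map_add, AddMonoidHom.add_apply, ha, hc]
      | @homogeneous j a =>
        rw [hq l (i + j) _ (M.smul_mem m.2 a.2), hq l i _ m.2, tmul_balanced]
        congr 1
        have := DirectSum.coe_decompose_mul_add_of_left_mem ℬ (j := l - (i + j)) (b := b)
          (hφ j a a.2)
        rw [show j + (l - (i + j)) = l - i by abel] at this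
        exact this.symm
  refine isInternal_of_proj _ (fun l => lift (q l) (hbal l)) ?_ ?_ ?_
  · intro l x hx
    induction hx using AddSubgroup.closure_induction with
    | mem x hx =>
      obtain ⟨i, j, rfl, m, hm, b, hb, rfl⟩ := hx
      rw [lift_tmul, hq _ i m hm, add_sub_cancel_left, projHom_same _ hb]
    | zero => exact map_zero _
    | add x y _ _ hx hy => rw [map_add, hx, hy]
    | neg x _ hx => rw [map_neg, hx]
  · intro l k hlk x hx
    induction hx using AddSubgroup.closure_induction with
    | mem x hx =>
      obtain ⟨i, j, rfl, m, hm, b, hb, rfl⟩ := hx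
      rw [lift_tmul, hq _ i m hm, projHom_ne _ hb, map_zero]
      rintro rfl
      exact hlk (by abel)
    | zero => exact map_zero _
    | add x y _ _ hx hy => rw [map_add, hx, hy, add_zero]
    | neg x _ hx => rw [map_neg, hx, neg_zero]
  · intro x
    induction x using induction with
    | zero => exact zero_mem _
    | add x y hx hy => exact add_mem hx hy
    | tmul m b =>
      induction m using DirectSum.Decomposition.inductionOn M.deg with
      | zero => simp only [map_zero, AddMonoidHom.zero_apply, zero_mem]
      | add m n hm hn =>
        rw [map_add]
        exact add_mem hm hn
      | @homogeneous i m =>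
        induction b using DirectSum.Decomposition.inductionOn ℬ with
        | zero => simp only [map_zero, zero_mem]
        | add b c hb hc =>
          rw [map_add]
          exact add_mem hb hc
        | @homogeneous j b =>
          exact AddSubgroup.mem_iSup_of_mem (i + j)
            (AddSubgroup.subset_closure ⟨i, j, rfl, m, m.2, b, b.2, rfl⟩)

end Tensor

/-- The graded right `B`-module `M ⊗_A B` for a graded right `A`-module `M` and a degree-preserving
(not necessarily unital) ring homomorphism `φ : A → B`. -/
def GrMod.tensor {𝒜 : Γ → AddSubgroup A} [GradedRing 𝒜] {ℬ : Γ → AddSubgroup B} [GradedRing ℬ]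
    (φ : A →ₙ+* B) (hφ : ∀ i, ∀ a ∈ 𝒜 i, φ a ∈ ℬ i) (M : GrMod 𝒜) : GrMod ℬ where
  carrier := Tensor φ M.carrier
  deg := Tensor.deg φ M.deg ℬ
  isInternal := Tensor.deg_isInternal φ hφ M
  smul_mem := by
    intro l k x c hx hc
    induction hx using AddSubgroup.closure_induction with
    | mem x hx =>
      obtain ⟨i, j, rfl, m, hm, b, hb, rfl⟩ := hx
      rw [Tensor.op_smul_tmul]
      exact AddSubgroup.subset_closure
        ⟨i, j + k, (add_assoc _ _ _).symm, m, hm, b * c, SetLike.mul_mem_graded hb hc, rfl⟩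
    | zero => rw [smul_zero]; exact zero_mem _
    | add x y _ _ hx hy => rw [smul_add]; exact add_mem hx hy
    | neg x _ hx => rw [smul_neg]; exact neg_mem hx

end BaseChange

/-! ### Graded matrix rings -/

section Matrices

variable {Γ : Type v} [DecidableEq Γ] [AddCommGroup Γ] {A : Type u} [Ring A] {n : ℕ}

/-- The grading of `M_n(A)(δ)`: a matrix `x` has degree `l` if
`x i j ∈ A_{l + δ j - δ i}` for all `i`, `j`. -/
def matrixGrading (𝒜 : Γ → AddSubgroup A) (δ : Fin n → Γ) (l : Γ) :
    AddSubgroup (Matrix (Fin n) (Fin n) A) where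
  carrier := {x | ∀ i j, x i j ∈ 𝒜 (l + δ j - δ i)}
  zero_mem' _ _ := zero_mem _
  add_mem' hx hy i j := add_mem (hx i j) (hy i j)
  neg_mem' hx i j := neg_mem (hx i j)

theorem single_mem_matrixGrading {𝒜 : Γ → AddSubgroup A} {δ : Fin n → Γ} {l : Γ} {i j : Fin n}
    {a : A} (ha : a ∈ 𝒜 (l + δ j - δ i)) : Matrix.single i j a ∈ matrixGrading 𝒜 δ l := by
  intro i' j'
  rw [Matrix.single_apply]
  split_ifs with h
  · obtain ⟨rfl, rfl⟩ := h
    exact ha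
  · exact zero_mem _

theorem matrixGrading_isInternal (𝒜 : Γ → AddSubgroup A) [GradedRing 𝒜] (δ : Fin n → Γ) :
    DirectSum.IsInternal (matrixGrading 𝒜 δ) := by
  refine isInternal_of_proj _ (fun l =>
    { toFun := fun x => Matrix.of fun i j => projHom 𝒜 (l + δ j - δ i) (x i j)
      map_zero' := by ext; simp
      map_add' := fun x y => by ext; simp }) ?_ ?_ ?_
  · intro l x hx
    ext i j
    exact projHom_same _ (hx i j)
  · intro l k hlk x hx
    ext i j
    refine projHom_ne _ (hx i j) fun h => hlk ?_
    simpa using h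
  · intro x
    rw [Matrix.matrix_eq_sum_single x]
    refine sum_mem fun i _ => sum_mem fun j _ => ?_
    generalize x i j = a
    induction a using DirectSum.Decomposition.inductionOn 𝒜 with
    | zero => rw [Matrix.single_zero]; exact zero_mem _
    | add a b ha hb => rw [Matrix.single_add]; exact add_mem ha hb
    | @homogeneous k a =>
      refine AddSubgroup.mem_iSup_of_mem (k + δ i - δ j) (single_mem_matrixGrading ?_)
      rw [show k + δ i - δ j + δ j - δ i = k by abel]
      exact a.2

/-- `M_n(A)(δ)` is a `Γ`-graded ring. -/
instance matrixGradedRing (𝒜 : Γ → AddSubgroup A) [GradedRing 𝒜] (δ : Fin n → Γ) :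
    GradedRing (matrixGrading 𝒜 δ) where
  one_mem i j := by
    rw [Matrix.one_apply]
    split_ifs with h
    · subst h
      rw [zero_add, sub_self]
      exact SetLike.one_mem_graded 𝒜
    · exact zero_mem _
  mul_mem := by
    intro l k x y hx hy i j
    rw [Matrix.mul_apply]
    refine sum_mem fun t _ => ?_
    have := SetLike.mul_mem_graded (hx i t) (hy t j)
    rwa [show l + δ t - δ i + (k + δ j - δ t) = l + k + δ j - δ i by abel] at this
  toDecomposition := (matrixGrading_isInternal 𝒜 δ).chooseDecomposition

/-- The inclusion `a ↦ a e_{1,1}` of `A` into the upper left corner of the `n × n` matrices,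
for `n ≥ 1`; it preserves products but not the unit. -/
def corner (A : Type u) [Ring A] (n : ℕ) [NeZero n] : A →ₙ+* Matrix (Fin n) (Fin n) A where
  toFun a := Matrix.single 0 0 a
  map_zero' := Matrix.single_zero 0 0
  map_add' := Matrix.single_add 0 0
  map_mul' a b := (Matrix.single_mul_single_same a 0 0 0 b).symm

theorem corner_mem (𝒜 : Γ → AddSubgroup A) [NeZero n] (δ : Fin n → Γ) :
    ∀ i, ∀ a ∈ 𝒜 i, corner A n a ∈ matrixGrading 𝒜 δ i := fun i a ha =>
  single_mem_matrixGrading (by rwa [add_sub_cancel_right])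

end Matrices

end GradedK0

end

noncomputable section

namespace GradedK0

open scoped RightActions

universe u v

/-! ### The corner of a module -/

section Corner

variable {A B : Type u} [Ring A] [Ring B] (φ : A →ₙ+* B)

/-! The proof is graded Morita theory for the idempotent e = e_{1,1} of B = M_n(A)(δ). The functor N
↦ Ne from graded right B-modules to graded right A-modules is taken as the basic object. It commutes
with direct sums and shifts almost by definition, whereas for P ↦ P ⊗_A B these properties would
need an argument.

On isomorphism classes the corner functor is bijective (`V.corner_bijective`). It is onto because M
≅ (M ⊗_A B)e by m ↦ m ⊗ e (`GrMod.iso_corner_tensor`). It is injective because 1 = ∑ e_{i,1}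
e_{1,i}: each x in N is ∑ (x e_{i,1}) e_{1,i}, so an isomorphism of corners extends to the modules,
and it preserves degrees since deg e_{i,1} + deg e_{1,i} = 0 (`GrMod.iso_of_corner_iso`).

Both functors preserve finitely generated projectives: `Tensor.finite`, `Tensor.projective`,
`Corner.finite`, `Corner.projective`. The inverse of the resulting monoid isomorphism sends [P] to
[P ⊗_A B]. It commutes with shifts, and it induces an order isomorphism of group completions because
the positive cone is the image of the monoid. -/

/-- The subgroup `N φ(1)` of a right `B`-module `N`, for a ring homomorphism `φ : A → B` that need
not preserve the unit. -/
def cornerSubgroup (N : Type u) [AddCommGroup N] [Module Bᵐᵒᵖ N] : AddSubgroup N where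
  carrier := {x | x <• φ 1 = x}
  zero_mem' := smul_zero _
  add_mem' {x y} hx hy := by
    change (x + y) <• φ 1 = x + y
    rw [smul_add, show x <• φ 1 = x from hx, show y <• φ 1 = y from hy]
  neg_mem' {x} hx := by
    change (-x) <• φ 1 = -x
    rw [smul_neg, show x <• φ 1 = x from hx]

/-- The corner `N φ(1)` of a right `B`-module `N`, as a right `A`-module. -/
def Corner (N : Type u) [AddCommGroup N] [Module Bᵐᵒᵖ N] : Type u := cornerSubgroup φ N

namespace Corner

variable {N N' : Type u} [AddCommGroup N] [Module Bᵐᵒᵖ N] [AddCommGroup N'] [Module Bᵐᵒᵖ N']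

instance : AddCommGroup (Corner φ N) := inferInstanceAs (AddCommGroup (cornerSubgroup φ N))

/-- The inclusion of the corner. -/
def val : Corner φ N →+ N := (cornerSubgroup φ N).subtype

variable {φ} in
theorem val_injective : Function.Injective (val φ : Corner φ N → N) := Subtype.val_injective

variable {φ} in
@[ext] theorem ext {x y : Corner φ N} (h : val φ x = val φ y) : x = y := val_injective h

theorem val_smul_one (x : Corner φ N) : val φ x <• φ 1 = val φ x := x.2

theorem smul_map_one_smul_map (x : N) (a : A) : (x <• φ a) <• φ 1 = x <• φ a := by
  rw [← mul_smul, ← MulOpposite.op_mul, ← map_mul, mul_one]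

theorem smul_map_smul_map (x : N) (a b : A) : (x <• φ a) <• φ b = x <• φ (a * b) := by
  rw [← mul_smul, ← MulOpposite.op_mul, ← map_mul]

/-- The element `x φ(a)` of the corner. -/
def mk (x : N) (a : A) : Corner φ N := ⟨x <• φ a, smul_map_one_smul_map φ x a⟩

@[simp] theorem val_mk (x : N) (a : A) : val φ (mk φ x a) = x <• φ a := rfl

theorem mk_val_one (x : Corner φ N) : mk φ (val φ x) 1 = x := ext (val_smul_one φ x)

instance : Module Aᵐᵒᵖ (Corner φ N) where
  smul a x := mk φ (val φ x) a.unop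
  one_smul x := mk_val_one φ x
  mul_smul a b x := ext (smul_map_smul_map φ (val φ x) b.unop a.unop).symm
  smul_zero a := ext (smul_zero _)
  smul_add a x y := ext (smul_add _ _ _)
  add_smul a b x := ext (by
    change val φ x <• φ (a.unop + b.unop) = val φ x <• φ a.unop + val φ x <• φ b.unop
    rw [map_add, MulOpposite.op_add, add_smul])
  zero_smul x := ext (by
    change val φ x <• φ 0 = 0
    rw [map_zero, MulOpposite.op_zero, zero_smul])

@[simp] theorem val_smul (a : A) (x : Corner φ N) : val φ (x <• a) = val φ x <• φ a := rfl

/-- The map of corners induced by a homomorphism. -/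
def map (f : N →ₗ[Bᵐᵒᵖ] N') : Corner φ N →ₗ[Aᵐᵒᵖ] Corner φ N' where
  toFun x := ⟨f (val φ x), by
    change f (val φ x) <• φ 1 = f (val φ x)
    rw [← map_smul, val_smul_one]⟩
  map_add' x y := ext (map_add f (val φ x) (val φ y))
  map_smul' a x := ext (map_smul f (MulOpposite.op (φ a.unop)) (val φ x))

@[simp] theorem val_map (f : N →ₗ[Bᵐᵒᵖ] N') (x : Corner φ N) : val φ (map φ f x) = f (val φ x) := rfl

theorem map_surjective {f : N →ₗ[Bᵐᵒᵖ] N'} (hf : Function.Surjective f) :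
    Function.Surjective (map φ f) := by
  intro y
  obtain ⟨x, hx⟩ := hf (val φ y)
  -- The preimage `x` need not lie in the corner; multiplying it by φ(1) puts it there and leaves
  -- its image `val φ y` unchanged.
  refine ⟨mk φ x 1, ext ?_⟩
  rw [val_map, val_mk, map_smul, hx, val_smul_one]

/-- The isomorphism of corners induced by an isomorphism. -/
def congr (e : N ≃ₗ[Bᵐᵒᵖ] N') : Corner φ N ≃ₗ[Aᵐᵒᵖ] Corner φ N' :=
  LinearEquiv.ofLinearMap (map φ e.toLinearMap) (map φ e.symm.toLinearMap)
    (LinearMap.ext fun _ => ext (e.apply_symm_apply _))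
    (LinearMap.ext fun _ => ext (e.symm_apply_apply _))

/-- The corner of a product is the product of the corners. -/
def prodEquiv : Corner φ (N × N') ≃ₗ[Aᵐᵒᵖ] Corner φ N × Corner φ N' :=
  LinearEquiv.ofLinearMap
    ((map φ (LinearMap.fst Bᵐᵒᵖ N N')).prod (map φ (LinearMap.snd Bᵐᵒᵖ N N')))
    ((map φ (LinearMap.inl Bᵐᵒᵖ N N')).coprod (map φ (LinearMap.inr Bᵐᵒᵖ N N')))
    (LinearMap.ext fun _ => Prod.ext (ext (add_zero _)) (ext (zero_add _)))
    (LinearMap.ext fun _ => ext (Prod.ext (add_zero _) (zero_add _)))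

end Corner

/-! ### Base change preserves finitely generated projective modules -/

namespace Tensor

variable {M : Type u} [AddCommGroup M] [Module Aᵐᵒᵖ M]

/-- Since m = m·1, balancing absorbs φ(1): only φ(1)B contributes to the tensor product, although φ
is not unital. -/
theorem tmul_map_one_mul (m : M) (b : B) : tmul φ m (φ 1 * b) = tmul φ m b := by
  rw [← tmul_balanced, MulOpposite.op_one, one_smul]

/-- The map `m ↦ m ⊗ φ(1)` into the corner of the tensor product. -/
def unit : M →ₗ[Aᵐᵒᵖ] Corner φ (Tensor φ M) where
  toFun m := ⟨tmul φ m (φ 1), by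
    change tmul φ m (φ 1 * φ 1) = tmul φ m (φ 1)
    rw [tmul_map_one_mul]⟩
  map_add' m n := Corner.ext (by
    change tmul φ (m + n) (φ 1) = tmul φ m (φ 1) + tmul φ n (φ 1)
    rw [map_add, AddMonoidHom.add_apply])
  map_smul' a m := Corner.ext (by
    change tmul φ (m <• a.unop) (φ 1) = tmul φ m (φ 1 * φ a.unop)
    rw [tmul_balanced, ← map_mul, ← map_mul, mul_one, one_mul])

/-- The biadditive function `(m, b) ↦ σ(m) b`. -/
def adjFun {X : Type u} [AddCommGroup X] [Module Bᵐᵒᵖ X] (σ : M →ₗ[Aᵐᵒᵖ] Corner φ X) :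
    M →+ B →+ X :=
  AddMonoidHom.mk' (fun m => AddMonoidHom.mk' (fun b => Corner.val φ (σ m) <• b)
    fun b c => by rw [MulOpposite.op_add, add_smul])
    fun m n => by
      ext b
      change Corner.val φ (σ (m + n)) <• b = Corner.val φ (σ m) <• b + Corner.val φ (σ n) <• b
      rw [map_add, map_add, smul_add]

/-- The additive map that underlies `Tensor.adj`. -/
def adjHom {X : Type u} [AddCommGroup X] [Module Bᵐᵒᵖ X] (σ : M →ₗ[Aᵐᵒᵖ] Corner φ X) :
    Tensor φ M →+ X :=
  lift (adjFun φ σ) fun m a b => by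
    change Corner.val φ (σ (m <• a)) <• b = Corner.val φ (σ m) <• (φ a * b)
    rw [map_smul, Corner.val_smul, MulOpposite.op_mul, mul_smul]

/-- The homomorphism `M ⊗_A B → X` that corresponds to a homomorphism from `M` to the corner
of `X`. -/
def adj {X : Type u} [AddCommGroup X] [Module Bᵐᵒᵖ X] (σ : M →ₗ[Aᵐᵒᵖ] Corner φ X) :
    Tensor φ M →ₗ[Bᵐᵒᵖ] X where
  toFun := adjHom φ σ
  map_add' := map_add _
  map_smul' c x := by
    rw [RingHom.id_apply]
    induction x using induction with
    | zero => rw [smul_zero, map_zero, smul_zero]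
    | tmul m b => exact mul_smul c (MulOpposite.op b) (Corner.val φ (σ m))
    | add x y hx hy => rw [smul_add, map_add, map_add, smul_add, hx, hy]

theorem adj_tmul {X : Type u} [AddCommGroup X] [Module Bᵐᵒᵖ X]
    (σ : M →ₗ[Aᵐᵒᵖ] Corner φ X) (m : M) (b : B) :
    adj φ σ (tmul φ m b) = Corner.val φ (σ m) <• b := rfl

/-- Base change is left adjoint to the corner functor, with unit `unit` and transpose `adj`, and the
corner functor preserves surjections; hence base change preserves projectives. -/
theorem projective [Module.Projective Aᵐᵒᵖ M] : Module.Projective Bᵐᵒᵖ (Tensor φ M) := by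
  refine Module.Projective.of_lifting_property'' fun g hg => ?_
  -- Lifting the unit through the corner of `g` gives `σ`; its transpose is a section of `g`.
  obtain ⟨σ, hσ⟩ := Module.projective_lifting_property (Corner.map φ g) (unit φ (M := M))
    (Corner.map_surjective φ hg)
  refine ⟨adj φ σ, LinearMap.ext fun x => ?_⟩
  induction x using induction with
  | zero => rw [map_zero, map_zero]
  | add x y hx hy => rw [map_add, hx, hy, map_add]
  | tmul m b =>
    have h : g (Corner.val φ (σ m)) = tmul φ m (φ 1) :=
      congrArg (Corner.val φ) (LinearMap.congr_fun hσ m)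
    rw [LinearMap.comp_apply, adj_tmul, map_smul, h, op_smul_tmul, tmul_map_one_mul,
      LinearMap.id_apply]

theorem finite [Module.Finite Aᵐᵒᵖ M] : Module.Finite Bᵐᵒᵖ (Tensor φ M) := by
  obtain ⟨S, hS, hspan⟩ := Submodule.fg_def.1 (Module.Finite.fg_top (R := Aᵐᵒᵖ) (M := M))
  refine ⟨Submodule.fg_def.2 ⟨(fun m => tmul φ m (φ 1)) '' S, hS.image _, ?_⟩⟩
  refine eq_top_iff.2 fun x _ => ?_
  induction x using induction with
  | zero => exact zero_mem _
  | add x y hx hy => exact add_mem (hx trivial) (hy trivial)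
  | tmul m b =>
    have hm : m ∈ Submodule.span Aᵐᵒᵖ S := hspan ▸ Submodule.mem_top
    -- The second factor must vary: in the scalar case `a` crosses the tensor sign and replaces `b`
    -- by φ(a)b.
    induction hm using Submodule.span_induction generalizing b with
    | mem m hm =>
      rw [← tmul_map_one_mul, ← op_smul_tmul]
      exact Submodule.smul_mem _ _ (Submodule.subset_span ⟨m, hm, rfl⟩)
    | zero => rw [map_zero]; exact zero_mem _
    | add m n _ _ hm hn => rw [map_add]; exact add_mem (hm b trivial) (hn b trivial)
    | smul a m _ hm => exact (tmul_balanced φ m a.unop b) ▸ hm (φ a.unop * b) trivial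

end Tensor

end Corner

/-! ### The corner of a matrix ring -/

section MatrixCorner

variable {A : Type u} [Ring A] {n : ℕ} [NeZero n]

variable (A) in
/-- The matrix unit `e_{i,1}`. -/
abbrev colUnit (i : Fin n) : Matrix (Fin n) (Fin n) A := Matrix.single i 0 1

variable (A) in
/-- The matrix unit `e_{1,i}`. -/
abbrev rowUnit (i : Fin n) : Matrix (Fin n) (Fin n) A := Matrix.single 0 i 1

/-- Both sides have column `i` of `b` as their first column and zeros elsewhere. The index 1 of the
matrix units is `0 : Fin n`. -/
theorem mul_single_zero_one (b : Matrix (Fin n) (Fin n) A) (i : Fin n) :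
    b * colUnit A i = ∑ j, colUnit A j * corner A n (b j i) := by
  ext k l
  rw [Matrix.sum_apply]
  change _ = ∑ j, (Matrix.single j 0 1 * Matrix.single 0 0 (b j i) : Matrix _ _ A) k l
  simp only [Matrix.single_mul_single_same, one_mul]
  by_cases hl : l = 0
  · subst hl
    rw [Matrix.mul_single_apply_same, mul_one, Finset.sum_eq_single k]
    · rw [Matrix.single_apply_same]
    · intro j _ hj
      rw [Matrix.single_apply_of_row_ne hj]
    · simp
  · rw [Matrix.mul_single_apply_of_ne _ _ _ _ _ hl, Finset.sum_eq_zero]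
    intro j _
    rw [Matrix.single_apply_of_col_ne _ _ (Ne.symm hl)]

theorem single_zero_one_mul (b : Matrix (Fin n) (Fin n) A) (i : Fin n) :
    rowUnit A i * b = ∑ j, corner A n (b i j) * rowUnit A j := by
  ext k l
  rw [Matrix.sum_apply]
  change _ = ∑ j, (Matrix.single 0 0 (b i j) * Matrix.single 0 j 1 : Matrix _ _ A) k l
  simp only [Matrix.single_mul_single_same, mul_one]
  by_cases hk : k = 0
  · subst hk
    rw [Matrix.single_mul_apply_same, one_mul, Finset.sum_eq_single l]
    · rw [Matrix.single_apply_same]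
    · intro j _ hj
      rw [Matrix.single_apply_of_col_ne _ _ hj]
    · simp
  · rw [Matrix.single_mul_apply_of_ne _ _ _ _ _ hk, Finset.sum_eq_zero]
    intro j _
    rw [Matrix.single_apply_of_row_ne (Ne.symm hk)]

theorem corner_one_mul_mul_corner_one (b : Matrix (Fin n) (Fin n) A) :
    corner A n 1 * (b * corner A n 1) = corner A n (b 0 0) := by
  change Matrix.single 0 0 1 * (b * Matrix.single 0 0 1) = Matrix.single 0 0 (b 0 0)
  rw [← mul_assoc, Matrix.single_mul_mul_single, one_mul, mul_one]

theorem single_mul_corner_one (i : Fin n) :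
    colUnit A i * corner A n 1 = colUnit A i := by
  change Matrix.single i 0 1 * Matrix.single 0 0 1 = _
  rw [Matrix.single_mul_single_same, one_mul]

/-- This exhibits 1 as an element of B e_{1,1} B, so e_{1,1} is a full idempotent; it is the reason
a module can be recovered from its corner. -/
theorem sum_single_mul_single :
    ∑ i : Fin n, colUnit A i * rowUnit A i = 1 := by
  simp only [Matrix.single_mul_single_same, one_mul, Matrix.sum_single_one]

/-! ### Recovering modules over the matrix ring from their corners -/

section Module

variable {N N' : Type u} [AddCommGroup N] [Module (Matrix (Fin n) (Fin n) A)ᵐᵒᵖ N]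
  [AddCommGroup N'] [Module (Matrix (Fin n) (Fin n) A)ᵐᵒᵖ N']

variable (A) in
/-- The component `x e_{i,1}` of an element of a module over a matrix ring. -/
def component (i : Fin n) : N →+ Corner (corner A n) N :=
  AddMonoidHom.mk' (fun x => Corner.mk (corner A n) (x <• colUnit A i) 1) fun x y =>
    Corner.ext (by simp only [Corner.val_mk, map_add, smul_add])

theorem val_component (i : Fin n) (x : N) :
    Corner.val (corner A n) (component A i x) = x <• colUnit A i := by
  change (x <• colUnit A i) <• corner A n 1 = _
  rw [← mul_smul, ← MulOpposite.op_mul, single_mul_corner_one]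

/-- The components of `x` form a row vector with entries in the corner, on which `b` acts by matrix
multiplication. -/
theorem component_smul (i : Fin n) (x : N) (b : Matrix (Fin n) (Fin n) A) :
    component A i (x <• b) = ∑ j, component A j x <• b j i := by
  refine Corner.ext ?_
  rw [val_component, map_sum, ← mul_smul, ← MulOpposite.op_mul, mul_single_zero_one,
    Finset.op_sum, Finset.sum_smul]
  refine Finset.sum_congr rfl fun j _ => ?_
  rw [Corner.val_smul, val_component, MulOpposite.op_mul, mul_smul]

theorem sum_val_component_smul (x : N) :
    ∑ i, Corner.val (corner A n) (component A i x) <• rowUnit A i = x := by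
  simp only [val_component, ← mul_smul, ← MulOpposite.op_mul]
  rw [← Finset.sum_smul, ← Finset.op_sum, sum_single_mul_single, MulOpposite.op_one, one_smul]

/-- The extension of a homomorphism of corners to a homomorphism of modules over the matrix
ring. -/
def Corner.extend (h : Corner (corner A n) N →ₗ[Aᵐᵒᵖ] Corner (corner A n) N') :
    N →ₗ[(Matrix (Fin n) (Fin n) A)ᵐᵒᵖ] N' where
  toFun x := ∑ i, Corner.val (corner A n) (h (component A i x)) <• rowUnit A i
  map_add' x y := by simp only [map_add, smul_add, Finset.sum_add_distrib]
  map_smul' b x := by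
    induction b using MulOpposite.rec' with | _ b
    rw [RingHom.id_apply, Finset.smul_sum]
    -- Moving `b` past e_{i,1} on the left side and past e_{1,i} on the right side gives the same
    -- double sum of the terms h(x e_{j,1}) b_{j,i} e_{1,i}, in opposite orders of summation.
    simp only [← mul_smul, ← MulOpposite.op_mul, single_zero_one_mul, component_smul, map_sum,
      map_smul, Corner.val_smul, Finset.sum_smul, Finset.op_sum]
    simp only [Finset.smul_sum, MulOpposite.op_mul, mul_smul]
    exact Finset.sum_comm

theorem Corner.extend_apply (h : Corner (corner A n) N →ₗ[Aᵐᵒᵖ] Corner (corner A n) N') (x : N) :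
    Corner.extend h x =
      ∑ i, Corner.val (corner A n) (h (component A i x)) <• rowUnit A i := rfl

theorem component_val (i : Fin n) (x : Corner (corner A n) N) :
    component A i (Corner.val (corner A n) x) = if i = 0 then x else 0 := by
  refine Corner.ext ?_
  rw [val_component]
  split_ifs with hi
  · subst hi
    exact x.2
  · rw [← Corner.val_smul_one, ← mul_smul, ← MulOpposite.op_mul]
    change Corner.val _ x <• (Matrix.single 0 0 1 * Matrix.single i 0 1) = 0
    rw [Matrix.single_mul_single_of_ne _ _ _ _ (Ne.symm hi), MulOpposite.op_zero, zero_smul]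

/-- The product e_{1,j} e_{i,1} is e_{1,1} if i = j and 0 otherwise. With `sum_val_component_smul`
this makes `N` a sum of `n` copies of its corner. -/
theorem component_smul_single (i j : Fin n) (x : Corner (corner A n) N) :
    component A i (Corner.val (corner A n) x <• rowUnit A j) =
      if i = j then x else 0 := by
  rw [component_smul, Finset.sum_eq_single 0]
  · rw [component_val, if_pos rfl, rowUnit, Matrix.single_apply]
    by_cases h : i = j
    · rw [if_pos ⟨rfl, h.symm⟩, if_pos h, MulOpposite.op_one, one_smul]
    · rw [if_neg fun h' => h h'.2.symm, if_neg h, MulOpposite.op_zero, zero_smul]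
  · intro k _ hk
    rw [component_val, if_neg hk, smul_zero]
  · simp

/-- The extension acts on each component by `h`, so the extensions of mutually inverse maps are
mutually inverse. -/
theorem component_extend (h : Corner (corner A n) N →ₗ[Aᵐᵒᵖ] Corner (corner A n) N') (i : Fin n)
    (x : N) : component A i (Corner.extend h x) = h (component A i x) := by
  rw [Corner.extend_apply, map_sum]
  simp only [component_smul_single]
  rw [Finset.sum_ite_eq, if_pos (Finset.mem_univ i)]

/-- The extension of an isomorphism of corners to an isomorphism of modules over the matrix
ring. -/
def Corner.extendEquiv (h : Corner (corner A n) N ≃ₗ[Aᵐᵒᵖ] Corner (corner A n) N') :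
    N ≃ₗ[(Matrix (Fin n) (Fin n) A)ᵐᵒᵖ] N' :=
  LinearEquiv.ofLinearMap (Corner.extend h.toLinearMap) (Corner.extend h.symm.toLinearMap)
    (LinearMap.ext fun x => by
      rw [LinearMap.comp_apply, Corner.extend_apply]
      simp only [component_extend, LinearEquiv.coe_coe, LinearEquiv.apply_symm_apply]
      exact sum_val_component_smul x)
    (LinearMap.ext fun x => by
      rw [LinearMap.comp_apply, Corner.extend_apply]
      simp only [component_extend, LinearEquiv.coe_coe, LinearEquiv.symm_apply_apply]
      exact sum_val_component_smul x)

theorem Corner.finite [Module.Finite (Matrix (Fin n) (Fin n) A)ᵐᵒᵖ N] :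
    Module.Finite Aᵐᵒᵖ (Corner (corner A n) N) := by
  obtain ⟨S, hS, hspan⟩ := Submodule.fg_def.1
    (Module.Finite.fg_top (R := (Matrix (Fin n) (Fin n) A)ᵐᵒᵖ) (M := N))
  refine ⟨Submodule.fg_def.2 ⟨⋃ i, component A i '' S, Set.finite_iUnion fun i => hS.image _, ?_⟩⟩
  -- The components of the generators generate the corner. All `i` are treated at once because the
  -- action of a matrix mixes the components.
  have key : ∀ x ∈ Submodule.span (Matrix (Fin n) (Fin n) A)ᵐᵒᵖ S, ∀ i,
      component A i x ∈ Submodule.span Aᵐᵒᵖ (⋃ i : Fin n, component A i '' S) := by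
    intro x hx
    induction hx using Submodule.span_induction with
    | mem x hx =>
      exact fun i => Submodule.subset_span (Set.mem_iUnion_of_mem i ⟨x, hx, rfl⟩)
    | zero => exact fun i => by rw [map_zero]; exact zero_mem _
    | add x y _ _ hx hy => exact fun i => by rw [map_add]; exact add_mem (hx i) (hy i)
    | smul b x _ hx =>
      intro i
      induction b using MulOpposite.rec' with | _ b
      rw [component_smul]
      exact sum_mem fun j _ => Submodule.smul_mem _ _ (hx j)
  refine eq_top_iff.2 fun x _ => ?_
  -- An element of the corner is its own component at index 0.
  have := key (Corner.val _ x) (hspan ▸ Submodule.mem_top) 0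
  rwa [component_val, if_pos rfl] at this

end Module

/-! ### Base change to the matrix ring, and projectivity of corners -/

section Tensor

variable {M : Type u} [AddCommGroup M] [Module Aᵐᵒᵖ M]

/-- The biadditive function `(m, b) ↦ m b_{1,1}`. -/
def smulEntry (n : ℕ) [NeZero n] (A M : Type u) [Ring A] [AddCommGroup M] [Module Aᵐᵒᵖ M] :
    M →+ Matrix (Fin n) (Fin n) A →+ M :=
  AddMonoidHom.mk' (fun m => AddMonoidHom.mk' (fun b => m <• b 0 0)
    fun b c => by rw [Matrix.add_apply, MulOpposite.op_add, add_smul])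
    fun m n => by
      ext b
      exact smul_add _ _ _

/-- The map `m ⊗ b ↦ m b_{1,1}`. -/
def Tensor.coord (n : ℕ) [NeZero n] (A M : Type u) [Ring A] [AddCommGroup M] [Module Aᵐᵒᵖ M] :
    Tensor (corner A n) M →+ M :=
  Tensor.lift (smulEntry n A M) fun m a b => by
    change (m <• a) <• b 0 0 = m <• (Matrix.single 0 0 a * b : Matrix (Fin n) (Fin n) A) 0 0
    rw [Matrix.single_mul_apply_same, MulOpposite.op_mul, mul_smul]

theorem Tensor.coord_tmul (m : M) (b : Matrix (Fin n) (Fin n) A) :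
    Tensor.coord n A M (Tensor.tmul _ m b) = m <• b 0 0 := rfl

theorem Tensor.coord_smul_corner (x : Tensor (corner A n) M) (a : A) :
    Tensor.coord n A M (x <• corner A n a) = Tensor.coord n A M x <• a := by
  induction x using Tensor.induction with
  | zero => rw [smul_zero, map_zero, smul_zero]
  | add x y hx hy => rw [smul_add, map_add, map_add, smul_add, hx, hy]
  | tmul m b =>
    rw [Tensor.op_smul_tmul, Tensor.coord_tmul, Tensor.coord_tmul]
    change m <• (b * Matrix.single 0 0 a : Matrix (Fin n) (Fin n) A) 0 0 = _
    rw [Matrix.mul_single_apply_same, MulOpposite.op_mul, mul_smul]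

/-- On generators, m b_{1,1} ⊗ e = m ⊗ e b e = m ⊗ b e with e = e_{1,1}. On the corner of the tensor
product, `coord` is therefore inverse to m ↦ m ⊗ e. -/
theorem Tensor.tmul_coord_corner_one (x : Tensor (corner A n) M) :
    Tensor.tmul (corner A n) (Tensor.coord n A M x) (corner A n 1) = x <• corner A n 1 := by
  induction x using Tensor.induction with
  | zero => rw [smul_zero, map_zero, map_zero, AddMonoidHom.zero_apply]
  | add x y hx hy => rw [smul_add, map_add, map_add, AddMonoidHom.add_apply, hx, hy]
  | tmul m b =>
    rw [Tensor.op_smul_tmul, Tensor.coord_tmul, Tensor.tmul_balanced, ← map_mul, mul_one,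
      ← Tensor.tmul_map_one_mul _ m (b * _), corner_one_mul_mul_corner_one]

/-- A module is the corner of its base change to the matrix ring. -/
def Tensor.unitEquiv (n : ℕ) [NeZero n] (A M : Type u) [Ring A] [AddCommGroup M]
    [Module Aᵐᵒᵖ M] : M ≃ₗ[Aᵐᵒᵖ] Corner (corner A n) (Tensor (corner A n) M) where
  __ := Tensor.unit (corner A n)
  invFun x := Tensor.coord n A M (Corner.val _ x)
  left_inv m := by
    change m <• (Matrix.single 0 0 1 : Matrix (Fin n) (Fin n) A) 0 0 = m
    rw [Matrix.single_apply_same, MulOpposite.op_one, one_smul]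
  right_inv x := Corner.ext ((Tensor.tmul_coord_corner_one _).trans (Corner.val_smul_one _ x))

/-- A surjection g : X → Ne has a transpose X ⊗_A B → N, which splits because `N` is projective.
Restricting the splitting to corners and identifying (X ⊗_A B)e with X by `coord` gives a section of
g. -/
theorem Corner.projective {N : Type u} [AddCommGroup N]
    [Module (Matrix (Fin n) (Fin n) A)ᵐᵒᵖ N]
    [Module.Projective (Matrix (Fin n) (Fin n) A)ᵐᵒᵖ N] :
    Module.Projective Aᵐᵒᵖ (Corner (corner A n) N) := by
  refine Module.Projective.of_lifting_property'' fun g hg => ?_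
  -- Fullness of e_{1,1} enters here: x = ∑ (x e_{i,1}) e_{1,i}, and each x e_{i,1} lifts through
  -- `g`.
  have hsurj : Function.Surjective (Tensor.adj (corner A n) g) := by
    intro x
    choose y hy using hg
    refine ⟨∑ i, Tensor.tmul _ (y (component A i x)) (rowUnit A i), ?_⟩
    rw [map_sum]
    simp only [Tensor.adj_tmul, hy]
    exact sum_val_component_smul x
  obtain ⟨σ, hσ⟩ := Module.projective_lifting_property _ LinearMap.id hsurj
  -- After multiplication by e_{1,1}, the transpose of `g` becomes `g` itself under `coord`.
  have hcoord : ∀ x, Corner.val _ (g (Tensor.coord n A _ x)) =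
      Tensor.adj (corner A n) g x <• corner A n 1 := by
    intro x
    induction x using Tensor.induction with
    | zero => simp only [map_zero, smul_zero]
    | add x y hx hy => simp only [map_add, smul_add, hx, hy]
    | tmul m b =>
      rw [Tensor.coord_tmul, Tensor.adj_tmul, map_smul, Corner.val_smul,
        ← corner_one_mul_mul_corner_one, MulOpposite.op_mul, mul_smul, Corner.val_smul_one,
        MulOpposite.op_mul, mul_smul]
  refine ⟨{ toFun := fun x => Tensor.coord n A _ (σ (Corner.val _ x))
            map_add' := fun x y => by simp only [map_add]
            map_smul' := fun a x => ?_ }, LinearMap.ext fun x => Corner.ext ?_⟩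
  · induction a using MulOpposite.rec' with | _ a
    rw [Corner.val_smul, map_smul, Tensor.coord_smul_corner]
    rfl
  · refine (hcoord _).trans ?_
    rw [show Tensor.adj _ g (σ (Corner.val _ x)) = _ from LinearMap.congr_fun hσ _]
    exact Corner.val_smul_one _ x

end Tensor

end MatrixCorner

/-! ### The corner of a graded module -/

section GradedCorner

variable {Γ : Type v} [DecidableEq Γ] [AddCommGroup Γ] {A B : Type u} [Ring A] [Ring B]
  {𝒜 : Γ → AddSubgroup A} {ℬ : Γ → AddSubgroup B}

theorem GrMod.smul_mem_of_mem_zero (N : GrMod ℬ) {b : B} (hb : b ∈ ℬ 0) {i : Γ} {x : N.carrier}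
    (hx : x ∈ N.deg i) : x <• b ∈ N.deg i := by
  simpa using N.smul_mem hx hb

/-- Right multiplication by a degree-zero element preserves each component. For b = φ(1) this keeps
the homogeneous components of a corner element inside the corner. -/
theorem GrMod.projHom_smul (N : GrMod ℬ) [DirectSum.Decomposition N.deg] {b : B} (hb : b ∈ ℬ 0)
    (i : Γ) (x : N.carrier) : projHom N.deg i (x <• b) = projHom N.deg i x <• b := by
  induction x using DirectSum.Decomposition.inductionOn N.deg with
  | zero => simp only [smul_zero, map_zero]
  | add x y hx hy => simp only [smul_add, map_add, hx, hy]
  | @homogeneous j x =>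
    by_cases h : j = i
    · subst h
      rw [projHom_same _ x.2, projHom_same _ (N.smul_mem_of_mem_zero hb x.2)]
    · rw [projHom_ne _ x.2 h, projHom_ne _ (N.smul_mem_of_mem_zero hb x.2) h, smul_zero]

variable [GradedRing 𝒜]

/-- The corner of a graded right `B`-module, as a graded right `A`-module. -/
def GrMod.cornerMod (φ : A →ₙ+* B) (hφ : ∀ i, ∀ a ∈ 𝒜 i, φ a ∈ ℬ i) (N : GrMod ℬ) : GrMod 𝒜 where
  carrier := Corner φ N.carrier
  deg i := (N.deg i).comap (Corner.val φ)
  isInternal := by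
    let _ := N.isInternal.chooseDecomposition
    have h1 : φ 1 ∈ ℬ 0 := hφ 0 1 (SetLike.one_mem_graded 𝒜)
    have hp : ∀ i (x : Corner φ N.carrier),
        projHom N.deg i (Corner.val φ x) <• φ 1 = projHom N.deg i (Corner.val φ x) := by
      intro i x
      rw [← N.projHom_smul h1, Corner.val_smul_one]
    refine isInternal_of_proj _ (fun i => AddMonoidHom.mk'
      (fun x => (⟨projHom N.deg i (Corner.val φ x), hp i x⟩ : Corner φ N.carrier))
      fun x y => Corner.ext (map_add (projHom N.deg i) (Corner.val φ x) (Corner.val φ y))) ?_ ?_ ?_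
    · exact fun i x hx => Corner.ext (projHom_same N.deg hx)
    · exact fun i j hij x hx => Corner.ext (projHom_ne N.deg hx hij)
    · intro x
      -- The homogeneous summands available in `N` may lie outside the corner; multiplication by
      -- φ(1) moves them into it without changing their degrees.
      have key : ∀ y ∈ ⨆ i, N.deg i,
          Corner.mk φ y 1 ∈ ⨆ i, (N.deg i).comap (Corner.val φ) := by
        intro y hy
        refine AddSubgroup.iSup_induction N.deg (C := fun y => Corner.mk φ y 1 ∈ _) hy ?_ ?_ ?_
        · exact fun i y hy => AddSubgroup.mem_iSup_of_mem i (N.smul_mem_of_mem_zero h1 hy)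
        · rw [show Corner.mk φ (0 : N.carrier) 1 = 0 from Corner.ext (smul_zero _)]
          exact zero_mem _
        · intro y z hy hz
          rw [show Corner.mk φ (y + z) 1 = Corner.mk φ y 1 + Corner.mk φ z 1 from
            Corner.ext (smul_add _ _ _)]
          exact add_mem hy hz
      rw [← Corner.mk_val_one φ x]
      exact key _ (mem_iSup_of_isInternal N.isInternal _)
  smul_mem hx ha := N.smul_mem hx (hφ _ _ ha)

variable (φ : A →ₙ+* B) (hφ : ∀ i, ∀ a ∈ 𝒜 i, φ a ∈ ℬ i)

theorem GrMod.Iso.corner {N N' : GrMod ℬ} :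
    N.Iso N' → (N.cornerMod φ hφ).Iso (N'.cornerMod φ hφ) := by
  rintro ⟨e, he⟩
  exact ⟨Corner.congr φ e, fun i x => he i (Corner.val φ x)⟩

theorem GrMod.corner_sum (N N' : GrMod ℬ) :
    ((N.sum N').cornerMod φ hφ).Iso ((N.cornerMod φ hφ).sum (N'.cornerMod φ hφ)) :=
  ⟨Corner.prodEquiv φ, fun _ _ => Iff.rfl⟩

theorem GrMod.corner_zero : ((GrMod.zero ℬ).cornerMod φ hφ).Iso (GrMod.zero 𝒜) := by
  refine ⟨⟨0, 0, fun x => Corner.ext (Subsingleton.elim (α := PUnit) _ _),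
    fun x => Subsingleton.elim (α := PUnit) _ _⟩, fun _ _ => ⟨fun _ => trivial, fun _ => trivial⟩⟩

end GradedCorner

/-! ### Graded modules over a graded matrix ring -/

section GradedMatrix

variable {Γ : Type v} [DecidableEq Γ] [AddCommGroup Γ] {A : Type u} [Ring A]
  {𝒜 : Γ → AddSubgroup A} {n : ℕ} [NeZero n] {δ : Fin n → Γ}

/-- For `b` of degree j the two shifts cancel on the diagonal, so b_{1,1} has degree j. -/
theorem GrMod.coord_mem (M : GrMod 𝒜) {i : Γ} {x : Tensor (corner A n) M.carrier}
    (hx : x ∈ Tensor.deg (corner A n) M.deg (matrixGrading 𝒜 δ) i) :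
    Tensor.coord n A M.carrier x ∈ M.deg i := by
  induction hx using AddSubgroup.closure_induction with
  | mem x hx =>
    obtain ⟨i, j, rfl, m, hm, b, hb, rfl⟩ := hx
    have h := hb 0 0
    rw [add_sub_cancel_right] at h
    exact M.smul_mem hm h
  | zero => rw [map_zero]; exact zero_mem _
  | add x y _ _ hx hy => rw [map_add]; exact add_mem hx hy
  | neg x _ hx => rw [map_neg]; exact neg_mem hx

variable [GradedRing 𝒜]

theorem colUnit_mem (i : Fin n) : colUnit A i ∈ matrixGrading 𝒜 δ (δ i - δ 0) :=
  single_mem_matrixGrading (by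
    rw [sub_add_cancel, sub_self]
    exact SetLike.one_mem_graded 𝒜)

theorem rowUnit_mem (i : Fin n) : rowUnit A i ∈ matrixGrading 𝒜 δ (δ 0 - δ i) :=
  single_mem_matrixGrading (by
    rw [sub_add_cancel, sub_self]
    exact SetLike.one_mem_graded 𝒜)

/-- Multiplying by e_{j,1} shifts the degree by δ_j - δ_1, `h` preserves it, and multiplying by
e_{1,j} shifts it back. -/
theorem extend_mem_deg {N N' : GrMod (matrixGrading 𝒜 δ)}
    (h : Corner (corner A n) N.carrier →ₗ[Aᵐᵒᵖ] Corner (corner A n) N'.carrier)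
    (hh : ∀ i x, Corner.val _ x ∈ N.deg i → Corner.val _ (h x) ∈ N'.deg i) {i : Γ} {x : N.carrier}
    (hx : x ∈ N.deg i) : Corner.extend h x ∈ N'.deg i := by
  rw [Corner.extend_apply]
  refine sum_mem fun j _ => ?_
  have h1 := hh (i + (δ j - δ 0)) (component A j x) (by
    rw [val_component]
    exact N.smul_mem hx (colUnit_mem j))
  have h2 := N'.smul_mem h1 (rowUnit_mem (δ := δ) j)
  rwa [show i + (δ j - δ 0) + (δ 0 - δ j) = i by abel] at h2

theorem GrMod.iso_of_corner_iso {N N' : GrMod (matrixGrading 𝒜 δ)} :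
    (N.cornerMod (corner A n) (corner_mem 𝒜 δ)).Iso (N'.cornerMod (corner A n) (corner_mem 𝒜 δ)) →
      N.Iso N' := by
  rintro ⟨e, he⟩
  refine ⟨Corner.extendEquiv e, fun i x => ⟨fun hx => ?_, fun hx => ?_⟩⟩
  · exact extend_mem_deg e.toLinearMap (fun i x hx => (he i x).1 hx) hx
  · rw [← (Corner.extendEquiv e).symm_apply_apply x]
    refine extend_mem_deg e.symm.toLinearMap (fun i y hy => (he i _).2 ?_) hx
    have h : e (e.symm y) = y := e.apply_symm_apply y
    exact Set.mem_of_eq_of_mem h hy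

theorem GrMod.iso_corner_tensor (M : GrMod 𝒜) :
    M.Iso ((M.tensor (corner A n) (corner_mem 𝒜 δ)).cornerMod (corner A n) (corner_mem 𝒜 δ)) := by
  refine ⟨Tensor.unitEquiv n A M.carrier, fun i m => ⟨fun hm => ?_, fun hm => ?_⟩⟩
  · exact AddSubgroup.subset_closure ⟨i, 0, add_zero i, m, hm, corner A n 1,
      corner_mem 𝒜 δ 0 1 (SetLike.one_mem_graded 𝒜), rfl⟩
  · rw [← (Tensor.unitEquiv n A M.carrier).symm_apply_apply m]
    exact M.coord_mem hm

/-! ### Isomorphism classes -/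

/-- Base change to the matrix ring of a finitely generated graded projective module. -/
def PGr.tensorMatrix (δ : Fin n → Γ) (P : PGr 𝒜) : PGr (matrixGrading 𝒜 δ) where
  toGrMod := P.toGrMod.tensor (corner A n) (corner_mem 𝒜 δ)
  finite := by
    have := P.finite
    exact Tensor.finite (corner A n)
  projective := by
    have := P.projective
    exact Tensor.projective (corner A n)

/-- The corner of a finitely generated graded projective module over the matrix ring. -/
def PGr.cornerMod (Q : PGr (matrixGrading 𝒜 δ)) : PGr 𝒜 where
  toGrMod := Q.toGrMod.cornerMod (corner A n) (corner_mem 𝒜 δ)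
  finite := by
    have := Q.finite
    exact Corner.finite
  projective := by
    have := Q.projective
    exact Corner.projective

variable (𝒜 δ) in
/-- Passage to the corner as a homomorphism between monoids of isomorphism classes. -/
def V.cornerHom : V (matrixGrading 𝒜 δ) →+ V 𝒜 where
  toFun := Quotient.map PGr.cornerMod fun _ _ h =>
    GrMod.Iso.corner (corner A n) (corner_mem 𝒜 δ) h
  map_zero' := Quotient.sound (GrMod.corner_zero (corner A n) (corner_mem 𝒜 δ))
  map_add' := by
    rintro ⟨P⟩ ⟨Q⟩
    exact Quotient.sound
      (GrMod.corner_sum (corner A n) (corner_mem 𝒜 δ) P.toGrMod Q.toGrMod)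

theorem V.corner_tensorMatrix (P : PGr 𝒜) :
    V.cornerHom 𝒜 δ (V.mk (P.tensorMatrix δ)) = V.mk P :=
  (Quotient.sound (GrMod.iso_corner_tensor P.toGrMod)).symm

/-- The corner carries the restricted grading, so both orders of the operations give the same module
with the same grading. -/
theorem V.corner_shift (γ : Γ) (x : V (matrixGrading 𝒜 δ)) :
    V.cornerHom 𝒜 δ (V.shift _ γ x) = V.shift 𝒜 γ (V.cornerHom 𝒜 δ x) := by
  obtain ⟨P⟩ := x
  exact Quotient.sound ⟨LinearEquiv.refl _ _, fun _ _ => Iff.rfl⟩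

theorem V.corner_bijective : Function.Bijective (V.cornerHom 𝒜 δ) := by
  refine ⟨?_, ?_⟩
  · rintro ⟨P⟩ ⟨Q⟩ h
    exact Quotient.sound (GrMod.iso_of_corner_iso (Quotient.exact h))
  · rintro ⟨P⟩
    exact ⟨V.mk (P.tensorMatrix δ), V.corner_tensorMatrix P⟩

end GradedMatrix

/-! ### Functoriality of the graded Grothendieck group -/

section Functoriality

variable {Γ : Type v} [DecidableEq Γ] [AddCommGroup Γ] {A B : Type u} [Ring A] [Ring B]
  {𝒜 : Γ → AddSubgroup A} {ℬ : Γ → AddSubgroup B}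

/-- The homomorphism of Grothendieck groups induced by a homomorphism of monoids. -/
def K0gr.map (ψ : V 𝒜 →+ V ℬ) : K0gr 𝒜 →+ K0gr ℬ :=
  Algebra.GrothendieckAddGroup.lift ((K0gr.of ℬ).comp ψ)

theorem K0gr.map_of (ψ : V 𝒜 →+ V ℬ) (x : V 𝒜) :
    K0gr.map ψ (K0gr.of 𝒜 x) = K0gr.of ℬ (ψ x) :=
  DFunLike.congr_fun (Algebra.GrothendieckAddGroup.lift.symm_apply_apply
    ((K0gr.of ℬ).comp ψ)) x

theorem K0gr.map_single_smul (ψ : V 𝒜 →+ V ℬ)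
    (hψ : ∀ γ x, ψ (V.shift 𝒜 γ x) = V.shift ℬ γ (ψ x)) (γ : Γ) (x : K0gr 𝒜) :
    K0gr.map ψ (AddMonoidAlgebra.single γ (1 : ℤ) • x) =
      AddMonoidAlgebra.single γ (1 : ℤ) • K0gr.map ψ x := by
  -- As an identity of additive homomorphisms, the claim can be checked on the classes [P].
  suffices h : (K0gr.map ψ).comp
      (DistribSMul.toAddMonoidHom (K0gr 𝒜) (AddMonoidAlgebra.single γ (1 : ℤ))) =
      (DistribSMul.toAddMonoidHom (K0gr ℬ) (AddMonoidAlgebra.single γ (1 : ℤ))).comp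
        (K0gr.map ψ) from DFunLike.congr_fun h x
  refine K0gr.hom_ext fun P => ?_
  change K0gr.map ψ (AddMonoidAlgebra.single γ (1 : ℤ) • K0gr.mk P) =
    AddMonoidAlgebra.single γ (1 : ℤ) • K0gr.map ψ (K0gr.mk P)
  obtain ⟨Q, hQ⟩ : ∃ Q, ψ (V.mk P) = V.mk Q :=
    (Quotient.exists_rep (ψ (V.mk P))).imp fun _ => Eq.symm
  have h : K0gr.map ψ (K0gr.mk P) = K0gr.mk Q :=
    (K0gr.map_of ψ _).trans (congrArg (K0gr.of ℬ) hQ)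
  rw [h, K0gr.single_smul_mk, K0gr.single_smul_mk]
  refine (K0gr.map_of ψ _).trans (congrArg (K0gr.of ℬ) ?_)
  exact (hψ γ (V.mk P)).trans (congrArg (V.shift ℬ γ) hQ)

theorem K0gr.map_smul (ψ : V 𝒜 →+ V ℬ)
    (hψ : ∀ γ x, ψ (V.shift 𝒜 γ x) = V.shift ℬ γ (ψ x)) (r : AddMonoidAlgebra ℤ Γ) (x : K0gr 𝒜) :
    K0gr.map ψ (r • x) = r • K0gr.map ψ x := by
  induction r using AddMonoidAlgebra.induction_linear with
  | zero => rw [zero_smul, zero_smul, map_zero]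
  | add r s hr hs => rw [add_smul, add_smul, map_add, hr, hs]
  | single γ k =>
    have h : AddMonoidAlgebra.single γ k = k • AddMonoidAlgebra.single γ (1 : ℤ) := by
      rw [AddMonoidAlgebra.smul_single, smul_eq_mul, mul_one]
    rw [h, smul_assoc, smul_assoc, map_zsmul, K0gr.map_single_smul ψ hψ]

/-- The isomorphism of Grothendieck groups induced by an isomorphism of monoids that is compatible
with shifts. -/
def K0gr.congr (ψ : V 𝒜 ≃+ V ℬ) (hψ : ∀ γ x, ψ (V.shift 𝒜 γ x) = V.shift ℬ γ (ψ x)) :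
    K0gr 𝒜 ≃ₗ[AddMonoidAlgebra ℤ Γ] K0gr ℬ where
  toFun := K0gr.map ψ.toAddMonoidHom
  map_add' := map_add _
  map_smul' := K0gr.map_smul ψ.toAddMonoidHom hψ
  invFun := K0gr.map ψ.symm.toAddMonoidHom
  left_inv := DFunLike.congr_fun (K0gr.hom_ext
    (f := (K0gr.map ψ.symm.toAddMonoidHom).comp (K0gr.map ψ.toAddMonoidHom))
    (g := AddMonoidHom.id _) fun _ =>
      (congrArg _ (K0gr.map_of _ _)).trans <| (K0gr.map_of _ _).trans <|
        congrArg (K0gr.of 𝒜) (ψ.symm_apply_apply _))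
  right_inv := DFunLike.congr_fun (K0gr.hom_ext
    (f := (K0gr.map ψ.toAddMonoidHom).comp (K0gr.map ψ.symm.toAddMonoidHom))
    (g := AddMonoidHom.id _) fun _ =>
      (congrArg _ (K0gr.map_of _ _)).trans <| (K0gr.map_of _ _).trans <|
        congrArg (K0gr.of ℬ) (ψ.apply_symm_apply _))

theorem K0gr.congr_mk (ψ : V 𝒜 ≃+ V ℬ) (hψ : ∀ γ x, ψ (V.shift 𝒜 γ x) = V.shift ℬ γ (ψ x))
    (P : PGr 𝒜) : K0gr.congr ψ hψ (K0gr.mk P) = K0gr.of ℬ (ψ (V.mk P)) :=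
  K0gr.map_of _ _

theorem K0gr.le_iff {x y : K0gr 𝒜} : x ≤ y ↔ ∃ z, y - x = K0gr.of 𝒜 z :=
  ⟨fun ⟨P, hP⟩ => ⟨V.mk P, hP⟩, fun ⟨z, hz⟩ => by
    obtain ⟨P, rfl⟩ := Quotient.exists_rep z
    exact ⟨P, hz⟩⟩

/-- The positive cones are the images of the two monoids, and `ψ` maps one monoid onto the other;
injectivity on the group completions gives the converse. -/
theorem K0gr.congr_le_congr (ψ : V 𝒜 ≃+ V ℬ)
    (hψ : ∀ γ x, ψ (V.shift 𝒜 γ x) = V.shift ℬ γ (ψ x)) (x y : K0gr 𝒜) :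
    K0gr.congr ψ hψ x ≤ K0gr.congr ψ hψ y ↔ x ≤ y := by
  rw [K0gr.le_iff, K0gr.le_iff, ← map_sub]
  refine ψ.surjective.exists.trans (exists_congr fun z => ?_)
  rw [show K0gr.of ℬ (ψ z) = K0gr.congr ψ hψ (K0gr.of 𝒜 z) from
      (K0gr.map_of ψ.toAddMonoidHom z).symm,
    (K0gr.congr ψ hψ).injective.eq_iff]

end Functoriality

end GradedK0

end

/-! ### The order isomorphism of graded Grothendieck groups -/

theorem mainTheorem8 {Γ : Type*} [DecidableEq Γ] [AddCommGroup Γ] {A : Type*} [Ring A]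
    (𝒜 : Γ → AddSubgroup A) [GradedRing 𝒜] (n : ℕ) [NeZero n] (δ : Fin n → Γ) :
    ∃ f : GradedK0.K0gr 𝒜 ≃ₗ[AddMonoidAlgebra ℤ Γ] GradedK0.K0gr (GradedK0.matrixGrading 𝒜 δ),
      (∀ x y, f x ≤ f y ↔ x ≤ y) ∧
      ∀ P : GradedK0.PGr 𝒜, ∃ Q : GradedK0.PGr (GradedK0.matrixGrading 𝒜 δ),
        Q.toGrMod = P.toGrMod.tensor (GradedK0.corner A n) (GradedK0.corner_mem 𝒜 δ) ∧
        f (GradedK0.K0gr.mk P) = GradedK0.K0gr.mk Q := by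
  -- Base change on classes is obtained as the inverse of the corner map, so its additivity comes
  -- for free.
  let ψ := (AddEquiv.ofBijective (GradedK0.V.cornerHom 𝒜 δ) GradedK0.V.corner_bijective).symm
  have hψ : ∀ γ x, ψ (GradedK0.V.shift 𝒜 γ x) = GradedK0.V.shift _ γ (ψ x) := by
    intro γ x
    refine ψ.symm.injective ?_
    rw [AddEquiv.symm_apply_apply]
    refine Eq.trans ?_ (GradedK0.V.corner_shift γ (ψ x)).symm
    exact congrArg (GradedK0.V.shift 𝒜 γ) (ψ.symm_apply_apply x).symm
  refine ⟨GradedK0.K0gr.congr ψ hψ, GradedK0.K0gr.congr_le_congr ψ hψ,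
    fun P => ⟨P.tensorMatrix δ, rfl, ?_⟩⟩
  refine (GradedK0.K0gr.congr_mk ψ hψ P).trans (congrArg (GradedK0.K0gr.of _) ?_)
  -- Writing [P] as the corner of [P ⊗_A B] lets `ψ` cancel against the corner map.
  rw [← GradedK0.V.corner_tensorMatrix (δ := δ) P]
  exact ψ.apply_symm_apply (GradedK0.V.mk (P.tensorMatrix δ))
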